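/- Fix $k$ with $2\le k<\omega$. A \emph{template of arity $k$} is a sequence $\mathcal H=\langle (H_n,E_n):n<\omega\rangle$ with a function $f_{\mathcal H}:\omega\to\omega\setminus\{0\}$, $\lim_n f_{\mathcal H}(n)=\infty$, such that for all $n$: $H_n$ is a natural number, identified with $\{0,\dots,H_n-1\}$, and $f_{\mathcal H}(n)\le H_n$; $E_n\subseteq H_n^k$ contains every $k$-tuple with fewer than $k$ distinct entries and is symmetric on tuples of $k$ distinct entries; and (Extension) for any $t=f_{\mathcal H}(n)$ tuples $(i^\ell_0,\dots,i^\ell_{k-2})\in H_n^{k-1}$, $\ell<t$, there is $s\in H_n$ with $(s,i^\ell_0,\dots,i^\ell_{k-2})\in E_n$ for all $\ell<t$. Let $X_{\mathcal H}$ be the set of finite sequences $\eta$ with $\eta(n)<H_n$ for all $n<\operatorname{lgn}(\eta)$. Let $T_0(\mathcal H)$ be the universal theory, in the language with a $k$-ary relation $R$ and unary predicates $Q_\eta$ ($\eta\in X_{\mathcal H}$), which says: $R$ is symmetric and holds only on tuples of $k$ distinct elements; $Q_{\langle\rangle}$ holds of everything; $Q_\nu\subseteq Q_\eta$ if $\eta$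 is an initial segment of $\nu$; for each $\eta\in X_{\mathcal H}$ of length $m$, the predicates $Q_{\eta^\frown\langle i\rangle}$, $i<H_m$, partition $Q_\eta$; and whenever $\eta_0,\dots,\eta_{k-1}\in X_{\mathcal H}$, $n<\min_j\operatorname{lgn}(\eta_j)$ and $(\eta_0(n),\dots,\eta_{k-1}(n))\notin E_n$, then $Q_{\eta_0}(x_0)\wedge\dots\wedge Q_{\eta_{k-1}}(x_{k-1})\Rightarrow\neg R(x_0,\dots,x_{k-1})$. A \emph{model completion} of a theory $T_0$ is a theory $T$ in the same language that implies $T_0$, such that every model of $T_0$ embeds in a model of $T$, and for every model $M$ of $T_0$ the theory $T\cup\operatorname{Diag}(M)$ is complete. For a theory $T$ and a formula $\varphi(\bar x,\bar y)$ let $\mathcal P$ be the set of complete types $p(\bar y)$ of $T$ over $\emptyset$ containing $\exists\bar x\,\varphi(\bar x,\bar y)$. The pair $(T,\varphi)$ is \emph{1167-like} if $T$ is countable and one can assign to each $p\in\mathcal P$ a function $f_p:\omega\to\omega$ such that: (i) (continuity) for every $p\in\mathcal P$ and $m<\omega$ there is $\psi(\bar y)\in p$ such that $f_q(m)=f_p(m)$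 for all $q\in\mathcal P$ with $\psi\in q$; (ii) for every $s\ge1$ there is $n<\omega$ such that, whenever $\bar a_0,\dots,\bar a_{s-1},\bar b_0,\dots,\bar b_{s-1}$ are tuples from a model of $T$ whose types over $\emptyset$ belong to $\mathcal P$, with $f_{\operatorname{tp}(\bar a_\ell)}\upharpoonright n=f_{\operatorname{tp}(\bar b_\ell)}\upharpoonright n$ for all $\ell<s$, if $\{\varphi(\bar x,\bar a_\ell):\ell<s\}$ is a partial type then so is $\{\varphi(\bar x,\bar b_\ell):\ell<s\}$. \textbf{Claim.} Let $\mathcal H$ be a template of arity $k\ge2$. Then $T_0(\mathcal H)$ has a model completion; and if $T$ is the model completion of $T_0(\mathcal H)$ and $\varphi(x;y_0,\dots,y_{k-2})=R(x,y_0,\dots,y_{k-2})$, then $(T,\varphi)$ is 1167-like. -/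

import Mathlib

open FirstOrder FirstOrder.Language

universe u v w

/-- `(V, E)` is a `k`-full hypergraph: on tuples of `k` distinct elements the edge relation is
symmetric, and it holds on every `k`-tuple having fewer than `k` distinct elements. -/
structure IsFullHypergraph {V : Type} {k : ℕ} (E : (Fin k → V) → Prop) : Prop where
  symm : ∀ x : Fin k → V, Function.Injective x → E x → ∀ σ : Equiv.Perm (Fin k), E (x ∘ σ)
  full : ∀ x : Fin k → V, ¬ Function.Injective x → E x

/-- A template of arity `k = d + 1`, where `1 ≤ d` (that is, `2 ≤ k`): a sequence of finite
`k`-full hypergraphs with vertex sets `{0, …, size n - 1}` and edge relations `edge n`, together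
with a function `f : ℕ → ℕ \ {0}` that tends to infinity. -/
structure Template (d : ℕ) where
  one_le : 1 ≤ d
  size : ℕ → ℕ
  edge : ∀ n, (Fin (d + 1) → Fin (size n)) → Prop
  f : ℕ → ℕ
  f_pos : ∀ n, 0 < f n
  f_tendsto : ∀ N, ∃ n, ∀ m, n ≤ m → N ≤ f m
  isFull : ∀ n, IsFullHypergraph (edge n)
  f_le_size : ∀ n, f n ≤ size n
  /-- Extension: any `f n` many `(k - 1)`-tuples have a common neighbour. -/
  extension : ∀ (n : ℕ) (i : Fin (f n) → Fin d → Fin (size n)),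
    ∃ s : Fin (size n), ∀ l, edge n (Fin.cons s (i l))

namespace Template

variable {d : ℕ} (H : Template d)

/-- The nodes of length `m` of the tree of `H`: sequences `η` of length `m` with
`η(n) < size n` for `n < m`. -/
abbrev Node (m : ℕ) : Type := (n : Fin m) → Fin (H.size n)

/-- `η` is an initial segment of `ν`. -/
def IsPrefix {m m' : ℕ} (η : H.Node m) (ν : H.Node m') : Prop :=
  ∃ h : m ≤ m', ∀ n : Fin m, η n = ν (Fin.castLE h n)

/-- `η` followed by the one further entry `i`. -/
def snoc {m : ℕ} (η : H.Node m) (i : Fin (H.size m)) : H.Node (m + 1) :=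
  Fin.snoc (α := fun n : Fin (m + 1) => Fin (H.size n)) η i

/-- The relation symbols: a `k`-ary `R` and a unary `Q_η` for each node `η` (of any length). -/
inductive Rel : ℕ → Type
  | R : Rel (d + 1)
  | Q {m : ℕ} (η : H.Node m) : Rel 1

/-- The language of `H`; it has no function symbols. -/
def lang : FirstOrder.Language.{0, 0} where
  Functions := fun _ => Empty
  Relations := H.Rel

/-- The symbol `R`, as a relation symbol of the language. -/
def symR : H.lang.Relations (d + 1) := Rel.R

/-- The symbol `Q_η`, as a relation symbol of the language. -/
def symQ {m : ℕ} (η : H.Node m) : H.lang.Relations 1 := Rel.Q η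

/-- The atomic formula `Q_η(x_i)` in the variables `x_0, …, x_{n-1}`. -/
def atomQ {m n : ℕ} (η : H.Node m) (i : Fin n) : H.lang.BoundedFormula Empty n :=
  (H.symQ η).boundedFormula fun _ => &i

/-- The atomic formula `R(x_{t 0}, …, x_{t (k-1)})` in the variables `x_0, …, x_{n-1}`. -/
def atomR {n : ℕ} (t : Fin (d + 1) → Fin n) : H.lang.BoundedFormula Empty n :=
  H.symR.boundedFormula fun j => &(t j)

/-- The axioms of the universal theory `T₀(H)`. -/
inductive Axiom₀ : H.lang.Sentence → Prop
  /-- `R` holds only on tuples of distinct elements. -/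
  | irrefl (i j : Fin (d + 1)) (hij : i ≠ j) :
      Axiom₀ (H.atomR id ⟹ ∼((&i : H.lang.Term (Empty ⊕ Fin (d + 1))) =' &j)).alls
  /-- `R` is symmetric. -/
  | symm (σ : Equiv.Perm (Fin (d + 1))) :
      Axiom₀ (H.atomR id ⟹ H.atomR σ).alls
  /-- `Q_⟨⟩` names everything. -/
  | root (η : H.Node 0) :
      Axiom₀ (H.atomQ η (0 : Fin 1)).alls
  /-- `Q_ν` refines `Q_η` when `η` is an initial segment of `ν`. -/
  | refine {m m' : ℕ} (η : H.Node m) (ν : H.Node m') (h : H.IsPrefix η ν) :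
      Axiom₀ (H.atomQ ν (0 : Fin 1) ⟹ H.atomQ η 0).alls
  /-- The immediate successors of `η` name disjoint sets. -/
  | disjoint {m : ℕ} (η : H.Node m) (i j : Fin (H.size m)) (hij : i ≠ j) :
      Axiom₀ (∼(H.atomQ (H.snoc η i) (0 : Fin 1) ⊓ H.atomQ (H.snoc η j) 0)).alls
  /-- The immediate successors of `η` cover `Q_η`. -/
  | cover {m : ℕ} (η : H.Node m) :
      Axiom₀ (H.atomQ η (0 : Fin 1) ⟹
        BoundedFormula.iSup fun i : Fin (H.size m) => H.atomQ (H.snoc η i) 0).alls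
  /-- If `⟨η_0(n), …, η_{k-1}(n)⟩` is not an edge of the `n`-th hypergraph, then `R` has no edge
  across `Q_{η_0}, …, Q_{η_{k-1}}`. -/
  | forbid (m : Fin (d + 1) → ℕ) (η : ∀ j, H.Node (m j)) (n : ℕ) (hn : ∀ j, n < m j)
      (h : ¬ H.edge n fun j => η j ⟨n, hn j⟩) :
      Axiom₀ ((BoundedFormula.iInf fun j => H.atomQ (η j) j) ⟹ ∼(H.atomR id)).alls

/-- The universal theory `T₀(H)`. -/
def T₀ : H.lang.Theory := {σ | H.Axiom₀ σ}

/-- The formula `φ(x; y_0, …, y_{k-2}) = R(x, y_0, …, y_{k-2})`. -/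
def edgeFormula : H.lang.Formula (Fin 1 ⊕ Fin d) :=
  H.symR.formula (Fin.cons (Term.var (Sum.inl 0)) fun i => Term.var (Sum.inr i))

end Template

section ModelTheory

variable {L : FirstOrder.Language.{u, v}}

/-- `T'` is a model completion of `T`: it implies `T`, every model of `T` embeds in a model of
`T'`, and for every model `M` of `T` the theory `T'` together with the diagram of `M` is complete,
i.e. any two models of `T'` that extend `M` satisfy the same formulas with parameters from `M`. -/
structure IsModelCompletion (T T' : L.Theory) : Prop where
  models : ∀ σ ∈ T, T' ⊨ᵇ σ
  embeds : ∀ M : T.ModelType.{u, v, w}, ∃ N : T'.ModelType.{u, v, w}, Nonempty (M ↪[L] N)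
  complete : ∀ (M : T.ModelType.{u, v, w}) (N₁ N₂ : T'.ModelType.{u, v, w})
    (e₁ : M ↪[L] N₁) (e₂ : M ↪[L] N₂) (n : ℕ) (φ : L.Formula (Fin n)) (a : Fin n → M),
    φ.Realize (e₁ ∘ a) ↔ φ.Realize (e₂ ∘ a)

/-- The formula `∃ x̄ φ(x̄, ȳ)`. -/
noncomputable def exFormula {p q : ℕ} (φ : L.Formula (Fin p ⊕ Fin q)) : L.Formula (Fin q) :=
  Formula.iExs (Fin p) (φ.relabel Sum.swap : L.Formula (Fin q ⊕ Fin p))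

/-- The set `𝒫` of complete types `p(ȳ)` over the empty set that contain `∃ x̄ φ(x̄, ȳ)`. -/
def typesP (T : L.Theory) {p q : ℕ} (φ : L.Formula (Fin p ⊕ Fin q)) :
    Set (T.CompleteType (Fin q)) :=
  {r | Formula.equivSentence (exFormula φ) ∈ r}

/-- The finite set of instances `{φ(x̄, a_l) : l < s}`, with parameters in the model `M`, is a
partial type. (As it is finite, being finitely satisfiable in `M` means being satisfied in `M`.) -/
def IsPartialType {M : Type w} [L.Structure M] {p q s : ℕ} (φ : L.Formula (Fin p ⊕ Fin q))
    (a : Fin s → Fin q → M) : Prop :=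
  ∃ x : Fin p → M, ∀ l, φ.Realize (Sum.elim x (a l))

/-- `(T, φ(x̄, ȳ))` is 1167-like. Only the values of `f` on `𝒫` matter. The parameters range over
all models of `T`, in place of one large model in which these embed. Countability of the language
gives that of every set of its sentences, so of `T`. -/
def Is1167Like (T : L.Theory) {p q : ℕ} (φ : L.Formula (Fin p ⊕ Fin q)) : Prop :=
  L.card ≤ Cardinal.aleph0 ∧
  ∃ f : T.CompleteType (Fin q) → ℕ → ℕ,
    (∀ r ∈ typesP T φ, ∀ m : ℕ, ∃ ψ : L.Formula (Fin q), Formula.equivSentence ψ ∈ r ∧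
      ∀ r' ∈ typesP T φ, Formula.equivSentence ψ ∈ r' → f r' m = f r m) ∧
    ∀ s : ℕ, 1 ≤ s → ∃ n : ℕ,
      ∀ (M : T.ModelType.{u, v, w}) (a b : Fin s → Fin q → M),
        (∀ l, T.typeOf (a l) ∈ typesP T φ) → (∀ l, T.typeOf (b l) ∈ typesP T φ) →
        (∀ l, ∀ i < n, f (T.typeOf (a l)) i = f (T.typeOf (b l)) i) →
        IsPartialType φ a → IsPartialType φ b

end ModelTheory

/-!
A model of `T₀(H)` is a `k`-uniform hypergraph whose vertices carry branches of the tree of `H`.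
Call it rich if, over finitely many of its vertices, every prescribed set of new edges is realized
by a new vertex in every `Q_ν`, as soon as it is permitted by the levels below `m`; here `m` is the
length of `ν`, and `H` is required to have so much extension from the level `m` on that the higher
levels impose no condition.

For the same reason vertices with prescribed edges can be added freely to any model, whence every
model embeds in a rich one. A back-and-forth argument between rich models shows that the truth of a
formula depends only on equalities, edges, and finitely many levels of the branches, so the theory
of rich models is a model completion of `T₀(H)`. The models of an arbitrary model completion are
existentially closed, hence rich. In a rich model the consistency of `s` instances of
`R(x, y_0, …, y_{k-2})` depends only on the branches of the parameters below a level at which there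
is enough extension for `s * (k - 1)` vertices.
-/

theorem exists_perm_of_range_eq {ι α : Type*} {f g : ι → α} (hf : Function.Injective f)
    (hg : Function.Injective g) (h : Set.range f = Set.range g) :
    ∃ σ : Equiv.Perm ι, f = g ∘ σ :=
  ⟨(Equiv.ofInjective f hf).trans ((Equiv.setCongr h).trans (Equiv.ofInjective g hg).symm),
    funext fun i => by simp [Equiv.apply_ofInjective_symm]⟩

theorem exists_eq_some_comp_or_eq_cons_none {ι : Type*} {n : ℕ} {t : Fin (n + 1) → Option ι}
    (ht : Function.Injective t) :
    (∃ s : Fin (n + 1) → ι, t = some ∘ s) ∨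
      ∃ (σ : Equiv.Perm (Fin (n + 1))) (s : Fin n → ι), t ∘ σ = Fin.cons none (some ∘ s) := by
  by_cases h : ∃ j, t j = none
  · obtain ⟨j, hj⟩ := h
    have h0 : (t ∘ Equiv.swap 0 j) 0 = none := by simpa using hj
    have hsucc (i : Fin n) : (t ∘ Equiv.swap 0 j) i.succ ≠ none := fun hi =>
      Fin.succ_ne_zero i ((ht.comp (Equiv.swap 0 j).injective) (hi.trans h0.symm))
    choose s hs using fun i => Option.ne_none_iff_exists.1 (hsucc i)
    exact .inr ⟨Equiv.swap 0 j, s, funext (Fin.cases h0 fun i => (hs i).symm)⟩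
  · push Not at h
    choose s hs using fun i => Option.ne_none_iff_exists.1 (h i)
    exact .inl ⟨s, funext fun i => (hs i).symm⟩

theorem sumElim_snoc_eq_comp {α β : Type*} {l : ℕ} (v : α → β) (xs : Fin l → β) (x : β) :
    Sum.elim v (Fin.snoc (α := fun _ => β) xs x) =
      (fun o : Option (α ⊕ Fin l) => o.elim x (Sum.elim v xs)) ∘
        Sum.elim (some ∘ Sum.inl) (Fin.snoc (α := fun _ => _) (some ∘ Sum.inr) none) := by
  funext i
  rcases i with i | i
  · rfl
  · cases i using Fin.lastCases <;> simp

section ModelTheory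

variable {L : FirstOrder.Language.{u, v}}

theorem isQF_iInf {α β : Type*} [Finite β] {n : ℕ} {φ : β → L.BoundedFormula α n}
    (h : ∀ b, (φ b).IsQF) : (BoundedFormula.iInf φ).IsQF := by
  have key (l : List β) : ((l.map φ).foldr (· ⊓ ·) ⊤).IsQF := by
    induction l with
    | nil => exact .top
    | cons b l ih => exact (h b).inf ih
  exact key _

theorem model_of_models {T T' : L.Theory} (h : ∀ σ ∈ T, T' ⊨ᵇ σ) (N : Type*) [L.Structure N]
    [N ⊨ T'] [Nonempty N] : N ⊨ T :=
  ⟨fun σ hσ => (h σ hσ).realize_sentence N⟩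

theorem IsModelCompletion.realize_of_isExistential {T T' : L.Theory}
    (h : IsModelCompletion.{u, v, w} T T') {N P : Type w} [L.Structure N] [N ⊨ T']
    [L.Structure P] [P ⊨ T] [Nonempty N] (e : N ↪[L] P) {n : ℕ}
    {φ : L.Formula (Fin n)} (hφ : φ.IsExistential) {a : Fin n → N}
    (hP : φ.Realize (e ∘ a)) : φ.Realize a := by
  have := model_of_models h.models N
  have : Nonempty P := ‹Nonempty N›.map e
  obtain ⟨N', ⟨e'⟩⟩ := h.embeds (.of T P)
  change P ↪[L] N' at e'
  refine (h.complete (.of T N) (.of T' N) N' (Embedding.refl L N) (e'.comp e) n φ a).2 ?_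
  have := hφ.realize_embedding e' hP
  rwa [Unique.eq_default (e' ∘ default)] at this

end ModelTheory

namespace Template

variable {d : ℕ} (H : Template d)

/-- The infinite branches of the tree of `H`. -/
abbrev Branch : Type := ∀ n, Fin (H.size n)

instance (n : ℕ) : NeZero (H.size n) := ⟨((H.f_pos n).trans_le (H.f_le_size n)).ne'⟩

variable {H}

/-- The initial segment of length `m` of a branch. -/
def restrict (b : H.Branch) (m : ℕ) : H.Node m := fun n => b n

theorem restrict_eq_of_le {b b' : H.Branch} {m m' : ℕ} (hm : m ≤ m')
    (h : restrict b m' = restrict b' m') : restrict b m = restrict b' m :=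
  funext fun n => congrFun h (Fin.castLE hm n)

theorem edge_comp_perm {n : ℕ} {x : Fin (d + 1) → Fin (H.size n)} (h : H.edge n x)
    (σ : Equiv.Perm (Fin (d + 1))) : H.edge n (x ∘ σ) := by
  by_cases hx : Function.Injective x
  · exact (H.isFull n).symm x hx h σ
  · exact (H.isFull n).full _ fun h' => hx (σ.injective_comp x |>.1 h')

theorem exists_common_neighbour {ι : Type*} [Finite ι] {n : ℕ} (h : Nat.card ι ≤ H.f n)
    (i : ι → Fin d → Fin (H.size n)) : ∃ s, ∀ l, H.edge n (Fin.cons s (i l)) := by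
  let e : ι ↪ Fin (H.f n) := (Finite.equivFin ι).toEmbedding.trans (Fin.castLEEmb h)
  obtain ⟨s, hs⟩ := H.extension n (Function.extend e i 0)
  exact ⟨s, fun l => by simpa only [e.injective.extend_apply] using hs (e l)⟩

variable (H)

/-- The vertex `s` of the `n`-th hypergraph may be joined to every listing of every member of `S`,
where the index `l` stands for the vertex `i l`. -/
def IsCompatible {ι : Type*} {n : ℕ} (s : Fin (H.size n)) (i : ι → Fin (H.size n))
    (S : Set (Set ι)) : Prop :=
  ∀ t : Fin d ↪ ι, Set.range t ∈ S → H.edge n (Fin.cons s (i ∘ t))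

variable {H} in
theorem IsCompatible.comp {ι κ : Type*} {n : ℕ} {s : Fin (H.size n)} {i : ι → Fin (H.size n)}
    {S : Set (Set ι)} (h : H.IsCompatible s i S) (e : κ ↪ ι) :
    H.IsCompatible s (i ∘ e) {X | e '' X ∈ S} := by
  intro t ht
  refine h (t.trans e) ?_
  rwa [Function.Embedding.coe_trans, Set.range_comp]

variable {H} in
theorem isCompatible_of_forall_exists {ι : Type*} {n : ℕ} {s : Fin (H.size n)}
    {i : ι → Fin (H.size n)} {S : Set (Set ι)}
    (h : ∀ X ∈ S, ∃ t : Fin d → ι, Function.Injective t ∧ Set.range t = X ∧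
      H.edge n (Fin.cons s (i ∘ t))) : H.IsCompatible s i S := by
  intro t' ht'
  obtain ⟨t, ht, htX, hedge⟩ := h _ ht'
  obtain ⟨σ, hσ⟩ := exists_perm_of_range_eq t'.injective ht htX.symm
  have hcons : (Fin.cons s (i ∘ t') : Fin (d + 1) → Fin (H.size n)) =
      Fin.cons s (i ∘ t) ∘ Equiv.Perm.decomposeFin.symm (0, σ) := by
    rw [hσ]
    funext j
    cases j using Fin.cases <;> simp
  exact hcons ▸ edge_comp_perm hedge _

/-- From the level `m` on, the extension property of `H` applies to all the injective `d`-tuples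
from `r` points at once; `r ^ d` is a bound for their number. -/
def IsDeep (r m : ℕ) : Prop := ∀ n, m ≤ n → r ^ d ≤ H.f n

theorem exists_isDeep (r : ℕ) : ∃ m, H.IsDeep r m := H.f_tendsto (r ^ d)

variable {H}

theorem IsDeep.mono {r r' m m' : ℕ} (h : H.IsDeep r m) (hr : r' ≤ r) (hm : m ≤ m') :
    H.IsDeep r' m' :=
  fun n hn => (Nat.pow_le_pow_left hr d).trans (h n (hm.trans hn))

theorem IsDeep.exists_isCompatible {ι : Type*} [Finite ι] {m n : ℕ} (h : H.IsDeep (Nat.card ι) m)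
    (hn : m ≤ n) (i : ι → Fin (H.size n)) (S : Set (Set ι)) : ∃ s, H.IsCompatible s i S := by
  have hcard : Nat.card (Fin d ↪ ι) ≤ H.f n :=
    calc
      Nat.card (Fin d ↪ ι) ≤ Nat.card (Fin d → ι) :=
        Nat.card_le_card_of_injective _ DFunLike.coe_injective
      _ = Nat.card ι ^ d := by simp [Nat.card_fun]
      _ ≤ H.f n := h n hn
  obtain ⟨s, hs⟩ := exists_common_neighbour hcard fun t => i ∘ t
  exact ⟨s, fun t _ => hs t⟩

theorem IsDeep.exists_branch {ι : Type*} [Finite ι] {m : ℕ} (h : H.IsDeep (Nat.card ι) m)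
    (β : ι → H.Branch) {ν : H.Node m} {S : Set (Set ι)}
    (hν : ∀ n : Fin m, H.IsCompatible (ν n) (fun l => β l n) S) :
    ∃ b : H.Branch, restrict b m = ν ∧ ∀ n, H.IsCompatible (b n) (fun l => β l n) S := by
  have key (n : ℕ) : ∃ s : Fin (H.size n), (∀ hn : n < m, s = ν ⟨n, hn⟩) ∧
      H.IsCompatible s (fun l => β l n) S := by
    rcases lt_or_ge n m with hn | hn
    · exact ⟨ν ⟨n, hn⟩, fun _ => rfl, hν ⟨n, hn⟩⟩
    · obtain ⟨s, hs⟩ := h.exists_isCompatible hn (fun l => β l n) S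
      exact ⟨s, fun hn' => absurd hn' hn.not_gt, hs⟩
  choose b hb hb' using key
  exact ⟨b, funext fun n => hb n n.2, hb'⟩

section Models

/-- The vertices listed by `x` form an edge of the hypergraph named by `R`. -/
abbrev Adj (H : Template d) {N : Type*} [H.lang.Structure N] (x : Fin (d + 1) → N) : Prop :=
  Structure.RelMap H.symR x

/-- With the branch `β x` assigned to each vertex `x`, the structure `N` is a uniform hypergraph
with edges only across tuples of branches allowed at every level, and `Q_η` names the set of
vertices whose branch passes through `η`. -/
structure IsBranching {N : Type*} [H.lang.Structure N] (β : N → H.Branch) : Prop where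
  injective : ∀ x : Fin (d + 1) → N, H.Adj x → Function.Injective x
  comp_perm : ∀ x : Fin (d + 1) → N, H.Adj x → ∀ σ : Equiv.Perm (Fin (d + 1)), H.Adj (x ∘ σ)
  symQ_iff : ∀ {m : ℕ} (η : H.Node m) (x : N),
    Structure.RelMap (H.symQ η) (fun _ => x) ↔ restrict (β x) m = η
  edge : ∀ x : Fin (d + 1) → N, H.Adj x → ∀ n, H.edge n fun j => β (x j) n

variable {N : Type*} [H.lang.Structure N]

theorem realize_atomQ {m n : ℕ} (η : H.Node m) (i : Fin n) (v : Empty → N) (x : Fin n → N) :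
    (H.atomQ η i).Realize v x ↔ Structure.RelMap (H.symQ η) (fun _ => x i) := Iff.rfl

theorem realize_atomR {n : ℕ} (t : Fin (d + 1) → Fin n) (v : Empty → N) (x : Fin n → N) :
    (H.atomR t).Realize v x ↔ H.Adj (x ∘ t) := Iff.rfl

theorem restrict_succ_eq_snoc (b : H.Branch) (m : ℕ) :
    restrict b (m + 1) = H.snoc (restrict b m) (b m) :=
  (Fin.snoc_init_self (restrict b (m + 1))).symm

theorem snoc_injective_right {m : ℕ} {η : H.Node m} {i j : Fin (H.size m)}
    (h : H.snoc η i = H.snoc η j) : i = j := by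
  simpa [snoc] using congrFun h (Fin.last m)

theorem IsBranching.model_T₀ {β : N → H.Branch} (h : H.IsBranching β) : N ⊨ H.T₀ := by
  refine ⟨fun σ hσ => ?_⟩
  cases hσ <;>
    refine BoundedFormula.realize_alls.2 fun x => ?_ <;>
    simp only [BoundedFormula.realize_imp, BoundedFormula.realize_not, BoundedFormula.realize_inf,
      BoundedFormula.realize_iSup, BoundedFormula.realize_iInf, realize_atomQ, realize_atomR,
      h.symQ_iff]
  case irrefl i j hij => exact fun hx hxij => hij (h.injective x hx hxij)
  case symm σ => exact fun hx => h.comp_perm x hx σ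
  case root => exact Subsingleton.elim _ _
  case refine η ν hην =>
    obtain ⟨hm, hην⟩ := hην
    rintro rfl
    exact funext fun n => (hην n).symm
  case disjoint m η i j hij => exact fun ⟨hi, hj⟩ => hij (snoc_injective_right (hi.symm.trans hj))
  case cover m η =>
    rintro rfl
    exact ⟨β (x 0) m, restrict_succ_eq_snoc _ m⟩
  case forbid m η n hn hE =>
    intro hη hx
    obtain rfl : (fun j => restrict (β (x j)) (m j)) = η := funext hη
    exact hE (h.edge x hx n)

section Branch

variable [N ⊨ H.T₀]

theorem realize_of_axiom₀ {n : ℕ} {φ : H.lang.BoundedFormula Empty n} (h : H.Axiom₀ φ.alls)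
    (x : Fin n → N) : φ.Realize default x :=
  BoundedFormula.realize_alls.1 (Theory.realize_sentence_of_mem H.T₀ h) x

theorem symQ_of_isPrefix {m m' : ℕ} {η : H.Node m} {ν : H.Node m'} {x : N}
    (h : H.IsPrefix η ν) (hν : Structure.RelMap (H.symQ ν) fun _ => x) :
    Structure.RelMap (H.symQ η) fun _ => x :=
  realize_of_axiom₀ (.refine η ν h) (fun _ => x) hν

theorem existsUnique_symQ (x : N) (m : ℕ) :
    ∃! η : H.Node m, Structure.RelMap (H.symQ η) fun _ => x := by
  induction m with
  | zero =>
    let η : H.Node 0 := fun n => n.elim0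
    exact ⟨η, realize_of_axiom₀ (.root η) (fun _ => x), fun _ _ => Subsingleton.elim _ _⟩
  | succ m ih =>
    obtain ⟨η, hη, hη_unique⟩ := ih
    obtain ⟨i, hi⟩ := BoundedFormula.realize_iSup.1
      (realize_of_axiom₀ (.cover η) (fun _ => x) hη)
    refine ⟨H.snoc η i, hi, fun ν hν => ?_⟩
    have hν_prefix : Fin.init ν = η :=
      hη_unique _ (symQ_of_isPrefix ⟨m.le_succ, fun _ => rfl⟩ hν)
    have hν_snoc : H.snoc η (ν (Fin.last m)) = ν := hν_prefix ▸ Fin.snoc_init_self ν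
    rw [← hν_snoc] at hν ⊢
    by_contra hne
    exact realize_of_axiom₀ (.disjoint η (ν (Fin.last m)) i fun h => hne (h ▸ rfl)) (fun _ => x)
      (BoundedFormula.realize_inf.2 ⟨hν, hi⟩)

variable (H) in
/-- The branch of a vertex `x` of a model of `T₀(H)`: its initial segments are the nodes `η` with
`Q_η(x)`. -/
noncomputable def branch (x : N) : H.Branch :=
  fun n => (existsUnique_symQ (H := H) x (n + 1)).choose (Fin.last n)

theorem symQ_iff_restrict_branch {m : ℕ} (η : H.Node m) (x : N) :
    Structure.RelMap (H.symQ η) (fun _ => x) ↔ restrict (H.branch x) m = η := by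
  obtain ⟨ν, hν, hν_unique⟩ := existsUnique_symQ (H := H) x m
  have hν_branch : restrict (H.branch x) m = ν := by
    funext n
    have hn := (existsUnique_symQ (H := H) x (n + 1)).choose_spec.2 (fun i => ν (Fin.castLE n.2 i))
      (symQ_of_isPrefix ⟨n.2, fun _ => rfl⟩ hν)
    exact (congrFun hn (Fin.last n)).symm
  rw [hν_branch]
  exact ⟨fun h => (hν_unique η h).symm, fun h => h ▸ hν⟩

theorem relMap_symQ_iff {m : ℕ} {η : H.Node m} {x : Fin 1 → N} :
    Structure.RelMap (H.symQ η) x ↔ restrict (H.branch (x 0)) m = η := by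
  have hx : x = fun _ => x 0 := funext fun i => congrArg x (Subsingleton.elim i 0)
  rw [hx]
  exact symQ_iff_restrict_branch η (x 0)

variable (H N) in
theorem isBranching_branch : H.IsBranching (H.branch : N → H.Branch) where
  injective x hx i j hij := by
    by_contra hne
    exact realize_of_axiom₀ (H := H) (.irrefl i j hne) x hx hij
  comp_perm x hx σ := realize_of_axiom₀ (H := H) (.symm σ) x hx
  symQ_iff := symQ_iff_restrict_branch
  edge x hx n := by
    by_contra hE
    refine realize_of_axiom₀ (.forbid (fun _ => n + 1) (fun j => restrict (H.branch (x j)) (n + 1))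
      n (fun _ => n.lt_succ_self) hE) x (BoundedFormula.realize_iInf.2 fun j => ?_) hx
    exact (symQ_iff_restrict_branch _ _).2 rfl

theorem IsBranching.branch_eq {β : N → H.Branch} (h : H.IsBranching β) (x : N) :
    H.branch x = β x := by
  funext n
  have hn := (symQ_iff_restrict_branch _ x).1 ((h.symQ_iff (restrict (β x) (n + 1)) x).2 rfl)
  exact congrFun hn (Fin.last n)

theorem Adj.injective {x : Fin (d + 1) → N} (h : H.Adj x) : Function.Injective x :=
  (isBranching_branch H N).injective x h

theorem Adj.edge {x : Fin (d + 1) → N} (h : H.Adj x) (n : ℕ) :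
    H.edge n fun j => H.branch (x j) n :=
  (isBranching_branch H N).edge x h n

theorem adj_comp_perm_iff {x : Fin (d + 1) → N} (σ : Equiv.Perm (Fin (d + 1))) :
    H.Adj (x ∘ σ) ↔ H.Adj x := by
  refine ⟨fun h => ?_, fun h => (isBranching_branch H N).comp_perm x h σ⟩
  simpa [Function.comp_assoc] using (isBranching_branch H N).comp_perm _ h σ.symm

theorem adj_iff_of_range_eq {x y : Fin (d + 1) → N} (hx : Function.Injective x)
    (hy : Function.Injective y) (h : Set.range x = Set.range y) : H.Adj x ↔ H.Adj y := by
  obtain ⟨σ, rfl⟩ := exists_perm_of_range_eq hx hy h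
  exact adj_comp_perm_iff σ

end Branch

section Rich

variable [N ⊨ H.T₀]

theorem Adj.edge_cons {x : Fin d → N} {y : N} (h : H.Adj (Fin.cons y x)) (n : ℕ) :
    H.edge n (Fin.cons (H.branch y n) fun i => H.branch (x i) n) := by
  convert h.edge n using 1
  funext j
  cases j using Fin.cases <;> rfl

variable (H) in
/-- The vertex `y` is new over the vertices `x i`, lies in `Q_ν`, and is joined to exactly those
`d`-element sets of vertices `x i` whose index sets belong to `S`. -/
structure HasLink {ι : Type*} {m : ℕ} (x : ι → N) (ν : H.Node m) (S : Set (Set ι)) (y : N) :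
    Prop where
  notMem_range : y ∉ Set.range x
  restrict_eq : restrict (H.branch y) m = ν
  adj_iff : ∀ t : Fin d ↪ ι, H.Adj (Fin.cons y (x ∘ t)) ↔ Set.range t ∈ S

variable (H N) in
/-- Over `r` vertices, every link that is allowed below a level which is deep for `r` is realized
in every `Q_ν` with `ν` of that level. -/
def IsRich : Prop :=
  ∀ (r m : ℕ), H.IsDeep r m → ∀ (x : Fin r ↪ N) (ν : H.Node m) (S : Set (Set (Fin r))),
    (∀ n : Fin m, H.IsCompatible (ν n) (fun i => H.branch (x i) n) S) → ∃ y, H.HasLink x ν S y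

theorem IsRich.exists_of_finite (h : H.IsRich N) {A : Set N} (hA : A.Finite) {m : ℕ}
    (hm : H.IsDeep A.ncard m) {ν : H.Node m} {S : Set (Set N)}
    (hν : ∀ n : Fin m, H.IsCompatible (ν n) (fun x => H.branch x n) S) :
    ∃ y ∉ A, restrict (H.branch y) m = ν ∧
      ∀ s : Fin d ↪ N, Set.range s ⊆ A → (H.Adj (Fin.cons y s) ↔ Set.range s ∈ S) := by
  have := hA.to_subtype
  let e : Fin A.ncard ≃ A := (Finite.equivFinOfCardEq (Nat.card_coe_set_eq A)).symm
  let x : Fin A.ncard ↪ N := e.toEmbedding.trans (Function.Embedding.subtype _)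
  have hx : Set.range x = A := (e.surjective.range_comp _).trans Subtype.range_coe
  obtain ⟨y, hyA, hyν, hy⟩ := h _ m hm x ν {X | x '' X ∈ S} fun n => (hν n).comp x
  refine ⟨y, hx ▸ hyA, hyν, fun s hs => ?_⟩
  choose t ht using fun j => (hx.symm ▸ hs (Set.mem_range_self j) : s j ∈ Set.range x)
  have hxt : x ∘ t = s := funext ht
  have ht_inj : Function.Injective t := .of_comp (f := x) (hxt ▸ s.injective)
  rw [← hxt, Set.range_comp]
  exact hy ⟨t, ht_inj⟩

end Rich

section Formulas

/-- The variable with index `i` lies in `Q_{η i}`, for all `i`. -/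
noncomputable def nodeFormula {ι : Type*} [Finite ι] {m : ℕ} (η : ι → H.Node m) :
    H.lang.Formula ι :=
  Formula.iInf fun i => (H.symQ (η i)).formula fun _ => Term.var i

variable (H) in
/-- The free variables take distinct values. -/
noncomputable def distinctFormula (r : ℕ) : H.lang.Formula (Fin r) :=
  Formula.iInf fun p : {p : Fin r × Fin r // p.1 ≠ p.2} =>
    ∼(Term.equal (Term.var p.1.1) (Term.var p.1.2))

open Classical in
variable (H) in
/-- The bound variable is joined to the free variables listed by `t` if `P` holds, and is not
joined to them otherwise. -/
noncomputable def joinFormula {r : ℕ} (t : Fin d → Fin r) (P : Prop) :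
    H.lang.BoundedFormula (Fin r) 1 :=
  let joined := H.symR.boundedFormula (Fin.cons &0 fun j => Term.var (Sum.inl (t j)))
  if P then joined else ∼joined

/-- The property `Template.HasLink`, of the bound variable over the free ones. -/
noncomputable def linkFormula {r m : ℕ} (ν : H.Node m) (S : Set (Set (Fin r))) :
    H.lang.BoundedFormula (Fin r) 1 :=
  (BoundedFormula.iInf fun i : Fin r =>
      ∼((&0 : H.lang.Term (Fin r ⊕ Fin 1)) =' Term.var (Sum.inl i))) ⊓
    (((H.symQ ν).boundedFormula fun _ => &0) ⊓
      BoundedFormula.iInf fun t : Fin d ↪ Fin r => H.joinFormula t (Set.range t ∈ S))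

/-- Over any distinct vertices in the sets `Q_{η i}` there is a vertex in `Q_ν` with link `S`. -/
noncomputable def linkSentence {r m : ℕ} (η : Fin r → H.Node m) (ν : H.Node m)
    (S : Set (Set (Fin r))) : H.lang.Sentence :=
  Formula.iAlls (Fin r) (Formula.relabel Sum.inr
    (H.distinctFormula r ⟹ (nodeFormula η ⟹ ∃' (linkFormula ν S))))

variable (H) in
/-- The theory of the rich models of `T₀(H)`. -/
def richTheory : H.lang.Theory :=
  H.T₀ ∪ {σ | ∃ (r m : ℕ) (η : Fin r → H.Node m) (ν : H.Node m) (S : Set (Set (Fin r))),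
    H.IsDeep r m ∧ (∀ n : Fin m, H.IsCompatible (ν n) (fun i => η i n) S) ∧
      σ = linkSentence η ν S}

theorem isQF_joinFormula {r : ℕ} (t : Fin d → Fin r) (P : Prop) : (H.joinFormula t P).IsQF := by
  have isQF_joined := (BoundedFormula.IsAtomic.rel H.symR (n := 1)
    (Fin.cons &0 fun j => Term.var (Sum.inl (t j)))).isQF
  rw [joinFormula]
  split_ifs
  exacts [isQF_joined, isQF_joined.not]

theorem isQF_linkFormula {r m : ℕ} (ν : H.Node m) (S : Set (Set (Fin r))) :
    (linkFormula ν S).IsQF :=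
  (isQF_iInf fun _ => (BoundedFormula.IsAtomic.equal _ _).isQF.not).inf
    ((BoundedFormula.IsAtomic.rel _ _).isQF.inf (isQF_iInf fun t => isQF_joinFormula t _))

theorem realize_joinFormula {r : ℕ} {t : Fin d → Fin r} {P : Prop} {x : Fin r → N}
    {y : Fin 1 → N} :
    (H.joinFormula t P).Realize x y ↔ (H.Adj (Fin.cons (y 0) (x ∘ t)) ↔ P) := by
  have realize_joined : (H.symR.boundedFormula
      (Fin.cons &0 fun j => Term.var (Sum.inl (t j)))).Realize x y ↔
        H.Adj (Fin.cons (y 0) (x ∘ t)) := by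
    rw [BoundedFormula.realize_rel]
    refine iff_of_eq (congrArg _ (funext fun j => ?_))
    cases j using Fin.cases <;> rfl
  rw [joinFormula]
  split_ifs with hP
  · rw [realize_joined, iff_true_right hP]
  · rw [BoundedFormula.realize_not, realize_joined, iff_false_right hP]

theorem realize_distinctFormula {r : ℕ} {x : Fin r → N} :
    (H.distinctFormula r).Realize x ↔ Function.Injective x := by
  simp only [distinctFormula, Formula.realize_iInf, Formula.realize_not, Formula.realize_equal,
    Term.realize_var, Subtype.forall, Prod.forall]
  exact forall₂_congr fun i j => not_imp_not

variable [N ⊨ H.T₀]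

theorem realize_nodeFormula {ι : Type*} [Finite ι] {m : ℕ} {η : ι → H.Node m} {x : ι → N} :
    (nodeFormula η).Realize x ↔ (fun i => restrict (H.branch (x i)) m) = η := by
  simp only [nodeFormula, Formula.realize_iInf, Formula.realize_rel, Term.realize_var,
    symQ_iff_restrict_branch, funext_iff (g := η)]

theorem realize_linkFormula {r m : ℕ} {ν : H.Node m} {S : Set (Set (Fin r))} {x : Fin r → N}
    {y : Fin 1 → N} : (linkFormula ν S).Realize x y ↔ H.HasLink x ν S (y 0) := by
  have realize_notMem : (∀ i, (∼((&0 : H.lang.Term (Fin r ⊕ Fin 1)) ='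
      Term.var (Sum.inl i))).Realize x y) ↔ y 0 ∉ Set.range x := by
    simp [BoundedFormula.realize_not, eq_comm]
  have realize_symQ : ((H.symQ ν).boundedFormula fun _ => &0).Realize x y ↔
      restrict (H.branch (y 0)) m = ν := symQ_iff_restrict_branch ν (y 0)
  rw [linkFormula, BoundedFormula.realize_inf, BoundedFormula.realize_inf,
    BoundedFormula.realize_iInf, BoundedFormula.realize_iInf, realize_notMem, realize_symQ]
  simp only [realize_joinFormula]
  exact ⟨fun ⟨h, h', h''⟩ => ⟨h, h', h''⟩, fun ⟨h, h', h''⟩ => ⟨h, h', h''⟩⟩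

theorem realize_linkSentence {r m : ℕ} {η : Fin r → H.Node m} {ν : H.Node m}
    {S : Set (Set (Fin r))} :
    N ⊨ linkSentence η ν S ↔ ∀ x : Fin r → N, Function.Injective x →
      (fun i => restrict (H.branch (x i)) m) = η → ∃ y, H.HasLink x ν S y := by
  rw [linkSentence, Sentence.Realize, Formula.realize_iAlls]
  refine forall_congr' fun x => ?_
  rw [Formula.realize_relabel, Sum.elim_comp_inr, Formula.realize_imp, realize_distinctFormula,
    Formula.realize_imp, realize_nodeFormula]
  simp only [Formula.Realize, BoundedFormula.realize_ex, realize_linkFormula]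
  rfl

theorem model_richTheory_iff : N ⊨ H.richTheory ↔ H.IsRich N := by
  rw [richTheory, Theory.model_union_iff, and_iff_right ‹_›, Theory.model_iff]
  constructor
  · intro h r m hm x ν S hν
    exact realize_linkSentence.1 (h _ ⟨r, m, _, ν, S, hm, hν, rfl⟩) x x.injective rfl
  · rintro h _ ⟨r, m, η, ν, S, hm, hν, rfl⟩
    refine realize_linkSentence.2 fun x hx hη => h r m hm ⟨x, hx⟩ ν S ?_
    subst hη
    exact hν

end Formulas

end Models

variable (H) in
/-- The vertices obtained from the set `M` by freely adding, again and again, a vertex in `Q_ν`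
with link `S` over finitely many given ones `p i`. -/
inductive FreeExt (M : Type w) : Type w
  | base : M → FreeExt M
  | new {r m : ℕ} (p : Fin r → FreeExt M) (ν : H.Node m) (S : Set (Set (Fin r))) : FreeExt M

namespace FreeExt

variable {M : Type w}

theorem base_injective : Function.Injective (base : M → H.FreeExt M) := fun _ _ => base.inj

/-- The number of stages in which a vertex is built. -/
def rank : H.FreeExt M → ℕ
  | base _ => 0
  | new p _ _ => (Finset.univ.sup fun i => rank (p i)) + 1

variable {r m : ℕ} {p : Fin r → H.FreeExt M} {ν : H.Node m} {S : Set (Set (Fin r))}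

theorem rank_lt_rank_new (i : Fin r) : (p i).rank < (new p ν S).rank :=
  Nat.lt_succ_of_le (Finset.le_sup (f := fun i => (p i).rank) (Finset.mem_univ i))

theorem new_notMem_image (X : Set (Fin r)) : new p ν S ∉ p '' X := by
  rintro ⟨i, -, hi⟩
  exact (rank_lt_rank_new i).ne (congrArg rank hi)

theorem new_eq_new_of_insert_eq {r' m' : ℕ} {q : Fin r' → H.FreeExt M} {ν' : H.Node m'}
    {S' : Set (Set (Fin r'))} {X : Set (Fin r)} {Y : Set (Fin r')}
    (h : insert (new p ν S) (p '' X) = insert (new q ν' S') (q '' Y)) :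
    new p ν S = new q ν' S' := by
  rcases h.subset (Set.mem_insert _ _) with heq | ⟨i', -, hi'⟩
  · exact heq
  rcases h.superset (Set.mem_insert _ _) with heq | ⟨i, -, hi⟩
  · exact heq.symm
  have hlt := rank_lt_rank_new (p := p) (ν := ν) (S := S) i
  have hlt' := rank_lt_rank_new (p := q) (ν := ν') (S := S') i'
  rw [hi] at hlt
  rw [hi'] at hlt'
  exact absurd hlt hlt'.asymm

variable [H.lang.Structure M]

variable (H M) in
/-- The candidates for edges: the old ones, and a new vertex together with a member of its link. -/
inductive IsEdgeSet : Set (H.FreeExt M) → Prop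
  | base (x : Fin (d + 1) → M) (hx : H.Adj x) : IsEdgeSet (Set.range (base ∘ x))
  | new {r m : ℕ} (p : Fin r → H.FreeExt M) (ν : H.Node m) {S : Set (Set (Fin r))}
      {X : Set (Fin r)} (hX : X ∈ S) : IsEdgeSet (insert (new p ν S) (p '' X))

theorem isEdgeSet_insert_new_iff (hp : Function.Injective p) {X : Set (Fin r)} :
    IsEdgeSet H M (insert (new p ν S) (p '' X)) ↔ X ∈ S := by
  refine ⟨fun hedge => ?_, .new p ν⟩
  generalize hY : insert (new p ν S) (p '' X) = Y at hedge
  cases hedge with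
  | base z =>
    obtain ⟨j, hj⟩ := hY.subset (Set.mem_insert _ _)
    nomatch hj
  | new p' ν' hX' =>
    cases new_eq_new_of_insert_eq hY
    have himage := subset_antisymm
      ((Set.insert_subset_insert_iff (new_notMem_image X)).1 hY.subset)
      ((Set.insert_subset_insert_iff (new_notMem_image _)).1 hY.superset)
    exact hp.image_injective himage ▸ hX'

variable [M ⊨ H.T₀]

/-- The branches of the vertices: a new one gets a branch through its node which allows its link at
every level, if there is one. -/
noncomputable def branching : H.FreeExt M → H.Branch
  | base x => H.branch x
  | new (m := m) p ν S => Classical.epsilon fun b : H.Branch =>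
      restrict b m = ν ∧ ∀ n, H.IsCompatible (b n) (fun i => branching (p i) n) S

noncomputable instance : H.lang.Structure (H.FreeExt M) where
  funMap f := f.elim
  RelMap {_} r := match r with
    | .R => fun x => Function.Injective x ∧ (∀ n, H.edge n fun j => branching (x j) n) ∧
        IsEdgeSet H M (Set.range x)
    | .Q (m := m) η => fun x => restrict (branching (x 0)) m = η

theorem adj_iff {x : Fin (d + 1) → H.FreeExt M} :
    H.Adj x ↔ Function.Injective x ∧ (∀ n, H.edge n fun j => branching (x j) n) ∧
      IsEdgeSet H M (Set.range x) := Iff.rfl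

variable (H M) in
theorem isBranching_branching : H.IsBranching (branching : H.FreeExt M → H.Branch) where
  injective _ hx := hx.1
  comp_perm x hx σ := adj_iff.2 ⟨hx.1.comp σ.injective, fun n => edge_comp_perm (hx.2.1 n) σ,
    (σ.surjective.range_comp x).symm ▸ hx.2.2⟩
  symQ_iff _ _ := Iff.rfl
  edge _ hx := hx.2.1

instance : H.FreeExt M ⊨ H.T₀ := (isBranching_branching H M).model_T₀

theorem branch_eq (x : H.FreeExt M) : H.branch x = branching x :=
  (isBranching_branching H M).branch_eq x

theorem adj_base_iff {x : Fin (d + 1) → M} : H.Adj (base (H := H) ∘ x) ↔ H.Adj x := by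
  refine ⟨fun ⟨hinj, _, hedge⟩ => ?_, fun hx => ⟨base_injective.comp hx.injective, hx.edge,
    .base x hx⟩⟩
  generalize hX : Set.range (base ∘ x) = X at hedge
  cases hedge with
  | base z hz =>
    rw [Set.range_comp, Set.range_comp] at hX
    exact (adj_iff_of_range_eq hinj.of_comp hz.injective (base_injective.image_injective hX)).2 hz
  | new p ν =>
    obtain ⟨j, hj⟩ := hX.superset (Set.mem_insert _ _)
    nomatch hj

variable (H M) in
/-- The embedding of a model of `T₀(H)` into its free extension. -/
noncomputable def embedding : M ↪[H.lang] H.FreeExt M where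
  toFun := base
  inj' := base_injective
  map_fun' f := f.elim
  map_rel' {_} r x := by
    cases r with
    | R => exact adj_base_iff
    | Q η =>
      refine Iff.trans ?_ (relMap_symQ_iff (x := x)).symm
      exact Iff.rfl

theorem hasLink_new {p : Fin r ↪ H.FreeExt M} (hr : H.IsDeep r m)
    (hν : ∀ n : Fin m, H.IsCompatible (ν n) (fun i => H.branch (p i) n) S) :
    H.HasLink p ν S (new p ν S) := by
  simp only [branch_eq] at hν
  have hr' : H.IsDeep (Nat.card (Fin r)) m := by rwa [Nat.card_fin]
  obtain ⟨hrestrict, hcompat⟩ : restrict (branching (new p ν S)) m = ν ∧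
      ∀ n, H.IsCompatible (branching (new p ν S) n) (fun i => branching (p i) n) S := by
    rw [branching]
    exact Classical.epsilon_spec (hr'.exists_branch (fun i => branching (p i)) hν)
  have hnew : new p ν S ∉ Set.range p := Set.image_univ ▸ new_notMem_image Set.univ
  refine ⟨hnew, by rwa [branch_eq], fun t => ?_⟩
  have hinj : Function.Injective (Fin.cons (new p ν S) (p ∘ t) : Fin (d + 1) → H.FreeExt M) :=
    Fin.cons_injective_iff.2 ⟨fun h => hnew (Set.range_comp_subset_range _ _ h),
      p.injective.comp t.injective⟩
  rw [adj_iff, Fin.range_cons, Set.range_comp, isEdgeSet_insert_new_iff p.injective]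
  refine ⟨fun h => h.2.2, fun ht => ⟨hinj, fun n => ?_, ht⟩⟩
  convert hcompat n t ht using 1
  funext j
  cases j using Fin.cases <;> rfl

variable (H M) in
theorem isRich : H.IsRich (H.FreeExt M) :=
  fun _ _ hr p ν S hν => ⟨new p ν S, hasLink_new hr hν⟩

end FreeExt

section BackAndForth

variable {N₁ N₂ : Type*} [H.lang.Structure N₁] [H.lang.Structure N₂] [N₁ ⊨ H.T₀] [N₂ ⊨ H.T₀]

variable (H) in
/-- The tuples `a` and `b` satisfy the same equalities, instances of `R`, and instances of `Q_η`
for `η` of length at most `m`. -/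
structure Similar (m : ℕ) {ι : Type*} (a : ι → N₁) (b : ι → N₂) : Prop where
  eq_iff : ∀ i j, a i = a j ↔ b i = b j
  adj_iff : ∀ t : Fin (d + 1) → ι, H.Adj (a ∘ t) ↔ H.Adj (b ∘ t)
  restrict_eq : ∀ i, restrict (H.branch (a i)) m = restrict (H.branch (b i)) m

namespace Similar

variable {m : ℕ} {ι : Type*} {a : ι → N₁} {b : ι → N₂}

theorem symm (h : H.Similar m a b) : H.Similar m b a :=
  ⟨fun i j => (h.eq_iff i j).symm, fun t => (h.adj_iff t).symm, fun i => (h.restrict_eq i).symm⟩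

theorem mono (h : H.Similar m a b) {m' : ℕ} (hm : m' ≤ m) : H.Similar m' a b :=
  ⟨h.eq_iff, h.adj_iff, fun i => restrict_eq_of_le hm (h.restrict_eq i)⟩

theorem comp (h : H.Similar m a b) {κ : Type*} (g : κ → ι) : H.Similar m (a ∘ g) (b ∘ g) :=
  ⟨fun i j => h.eq_iff (g i) (g j), fun t => h.adj_iff (g ∘ t), fun i => h.restrict_eq (g i)⟩

theorem injective_comp_iff (h : H.Similar m a b) {κ : Type*} {g : κ → ι} :
    Function.Injective (a ∘ g) ↔ Function.Injective (b ∘ g) :=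
  forall₂_congr fun i j => imp_congr_left (h.eq_iff (g i) (g j))

theorem range_comp_eq_iff (h : H.Similar m a b) {κ κ' : Type*} {g : κ → ι} {g' : κ' → ι} :
    Set.range (a ∘ g) = Set.range (a ∘ g') ↔ Set.range (b ∘ g) = Set.range (b ∘ g') := by
  simp only [subset_antisymm_iff, Set.range_subset_iff, Set.mem_range, Function.comp_apply,
    h.eq_iff]

theorem option (h : H.Similar m a b) {x : N₁} {y : N₂} (hx : x ∉ Set.range a)
    (hy : y ∉ Set.range b) (hxy : restrict (H.branch x) m = restrict (H.branch y) m)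
    (hadj : ∀ t : Fin d → ι, H.Adj (Fin.cons x (a ∘ t)) ↔ H.Adj (Fin.cons y (b ∘ t))) :
    H.Similar m (fun o : Option ι => o.elim x a) (fun o : Option ι => o.elim y b) where
  eq_iff
    | none, none => iff_of_true rfl rfl
    | none, some j => iff_of_false (fun h => hx ⟨j, h.symm⟩) fun h => hy ⟨j, h.symm⟩
    | some i, none => iff_of_false (fun h => hx ⟨i, h⟩) fun h => hy ⟨i, h⟩
    | some i, some j => h.eq_iff i j
  adj_iff t := by
    by_cases ht : Function.Injective t
    · rcases exists_eq_some_comp_or_eq_cons_none ht with ⟨s, rfl⟩ | ⟨σ, s, hs⟩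
      · exact h.adj_iff s
      · rw [← adj_comp_perm_iff σ, Function.comp_assoc, hs, Fin.comp_cons,
          ← adj_comp_perm_iff (N := N₂) σ, Function.comp_assoc, hs, Fin.comp_cons]
        exact hadj s
    · exact iff_of_false (fun hadj => ht hadj.injective.of_comp) fun hadj =>
        ht hadj.injective.of_comp
  restrict_eq
    | none => hxy
    | some i => h.restrict_eq i

variable (H) in
/-- The link of `x` over `a`, carried over to `b`. -/
def transferLink (x : N₁) (a : ι → N₁) (b : ι → N₂) : Set (Set N₂) :=
  {X | ∃ t : Fin d → ι, H.Adj (Fin.cons x (a ∘ t)) ∧ Set.range (b ∘ t) = X}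

theorem isCompatible_transferLink (h : H.Similar m a b) (x : N₁) (n : Fin m) :
    H.IsCompatible (H.branch x n) (fun y : N₂ => H.branch y n) (transferLink H x a b) := by
  refine isCompatible_of_forall_exists ?_
  rintro _ ⟨t, ht, rfl⟩
  refine ⟨b ∘ t, h.injective_comp_iff.1 (Fin.cons_injective_iff.1 ht.injective).2, rfl, ?_⟩
  convert ht.edge_cons n using 2
  exact funext fun j => (congrFun (h.restrict_eq (t j)) n).symm

theorem range_comp_mem_transferLink_iff (h : H.Similar m a b) {x : N₁} (hx : x ∉ Set.range a)
    {t : Fin d → ι} (ht : Function.Injective (b ∘ t)) :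
    Set.range (b ∘ t) ∈ transferLink H x a b ↔ H.Adj (Fin.cons x (a ∘ t)) := by
  refine ⟨fun ⟨s, hs, hst⟩ => ?_, fun hadj => ⟨t, hadj, rfl⟩⟩
  have hinj : Function.Injective (Fin.cons x (a ∘ t) : Fin (d + 1) → N₁) :=
    Fin.cons_injective_iff.2 ⟨fun hxt => hx (Set.range_comp_subset_range _ _ hxt),
      h.injective_comp_iff.2 ht⟩
  refine (adj_iff_of_range_eq hinj hs.injective ?_).2 hs
  rw [Fin.range_cons, Fin.range_cons, h.range_comp_eq_iff.2 hst]

theorem exists_option [Finite ι] (h : H.Similar m a b) (hN₂ : H.IsRich N₂)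
    (hm : H.IsDeep (Nat.card ι) m) (x : N₁) :
    ∃ y, H.Similar m (fun o : Option ι => o.elim x a) (fun o : Option ι => o.elim y b) := by
  by_cases hx : x ∈ Set.range a
  · obtain ⟨i, rfl⟩ := hx
    refine ⟨b i, ?_⟩
    convert h.comp fun o : Option ι => o.elim i id using 1 <;>
      exact funext fun o => by cases o <;> rfl
  have hcard : (Set.range b).ncard ≤ Nat.card ι := Finite.card_range_le b
  obtain ⟨y, hy, hyx, hadj⟩ := hN₂.exists_of_finite (Set.finite_range b) (hm.mono hcard le_rfl)
    (h.isCompatible_transferLink x)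
  refine ⟨y, h.option hx hy hyx.symm fun t => ?_⟩
  by_cases ht : Function.Injective (b ∘ t)
  · exact (h.range_comp_mem_transferLink_iff hx ht).symm.trans
      (hadj ⟨b ∘ t, ht⟩ (Set.range_comp_subset_range t b)).symm
  · refine iff_of_false (fun hadj => ht (h.injective_comp_iff.1 ?_)) fun hadj => ht ?_
    · exact (Fin.cons_injective_iff.1 hadj.injective).2
    · exact (Fin.cons_injective_iff.1 hadj.injective).2

theorem exists_snoc {α : Type*} [Finite α] {l : ℕ} {v : α → N₁} {v' : α → N₂} {xs : Fin l → N₁}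
    {ys : Fin l → N₂} (h : H.Similar m (Sum.elim v xs) (Sum.elim v' ys)) (hN₂ : H.IsRich N₂)
    (hm : H.IsDeep (Nat.card (α ⊕ Fin l)) m) (x : N₁) :
    ∃ y, H.Similar m (Sum.elim v (Fin.snoc (α := fun _ => N₁) xs x))
      (Sum.elim v' (Fin.snoc (α := fun _ => N₂) ys y)) := by
  obtain ⟨y, hy⟩ := h.exists_option hN₂ hm x
  refine ⟨y, ?_⟩
  rw [sumElim_snoc_eq_comp v, sumElim_snoc_eq_comp v']
  exact hy.comp _

end Similar

end BackAndForth

section Determined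

variable {α : Type u} {l m : ℕ}

/-- In rich models, the truth of `φ` depends only on the quantifier-free type of the variables up
to the level `m`. -/
def IsDeterminedAt (φ : H.lang.BoundedFormula α l) (m : ℕ) : Prop :=
  ∀ ⦃N₁ N₂ : Type w⦄ [H.lang.Structure N₁] [H.lang.Structure N₂] [N₁ ⊨ H.T₀] [N₂ ⊨ H.T₀],
    H.IsRich N₁ → H.IsRich N₂ →
    ∀ ⦃v : α → N₁⦄ ⦃v' : α → N₂⦄ ⦃xs : Fin l → N₁⦄ ⦃ys : Fin l → N₂⦄,
      H.Similar m (Sum.elim v xs) (Sum.elim v' ys) → (φ.Realize v xs ↔ φ.Realize v' ys)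

namespace IsDeterminedAt

theorem mono {φ : H.lang.BoundedFormula α l} (h : IsDeterminedAt.{u, w} φ m) {m' : ℕ}
    (hm : m ≤ m') : IsDeterminedAt.{u, w} φ m' :=
  fun _ _ _ _ _ _ h₁ h₂ _ _ _ _ hs => h h₁ h₂ (hs.mono hm)

theorem imp {φ ψ : H.lang.BoundedFormula α l} (hφ : IsDeterminedAt.{u, w} φ m)
    (hψ : IsDeterminedAt.{u, w} ψ m) : IsDeterminedAt.{u, w} (φ ⟹ ψ) m :=
  fun _ _ _ _ _ _ h₁ h₂ _ _ _ _ hs => imp_congr (hφ h₁ h₂ hs) (hψ h₁ h₂ hs)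

theorem all [Finite α] {φ : H.lang.BoundedFormula α (l + 1)} (h : IsDeterminedAt.{u, w} φ m)
    (hm : H.IsDeep (Nat.card (α ⊕ Fin l)) m) : IsDeterminedAt.{u, w} (∀' φ) m := by
  intro N₁ N₂ _ _ _ _ h₁ h₂ v v' xs ys hs
  refine ⟨fun hφ y => ?_, fun hφ x => ?_⟩
  · obtain ⟨x, hx⟩ := hs.symm.exists_snoc h₁ hm y
    exact (h h₁ h₂ hx.symm).1 (hφ x)
  · obtain ⟨y, hy⟩ := hs.exists_snoc h₂ hm x
    exact (h h₁ h₂ hy).2 (hφ y)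

end IsDeterminedAt

theorem exists_eq_var {β : Type*} (t : H.lang.Term β) : ∃ i, t = Term.var i := by
  cases t with
  | var i => exact ⟨i, rfl⟩
  | func f => exact f.elim

theorem exists_isDeterminedAt [Finite α] (φ : H.lang.BoundedFormula α l) :
    ∃ m, IsDeterminedAt.{u, w} φ m := by
  induction φ with
  | falsum => exact ⟨0, fun _ _ _ _ _ _ _ _ _ _ _ _ _ => Iff.rfl⟩
  | equal t₁ t₂ =>
    obtain ⟨i, rfl⟩ := exists_eq_var t₁
    obtain ⟨j, rfl⟩ := exists_eq_var t₂
    exact ⟨0, fun _ _ _ _ _ _ _ _ _ _ _ _ hs => hs.eq_iff i j⟩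
  | rel r ts =>
    choose t ht using fun i => exists_eq_var (ts i)
    obtain rfl : ts = fun i => Term.var (t i) := funext ht
    cases r with
    | R => exact ⟨0, fun _ _ _ _ _ _ _ _ _ _ _ _ hs => hs.adj_iff t⟩
    | @Q m η =>
      refine ⟨m, fun _ _ _ _ _ _ _ _ v v' xs ys hs => ?_⟩
      exact (relMap_symQ_iff (x := Sum.elim v xs ∘ t)).trans
        ((hs.restrict_eq (t 0)).congr_left.trans (relMap_symQ_iff (x := Sum.elim v' ys ∘ t)).symm)
  | imp φ ψ hφ hψ =>
    obtain ⟨m₁, hm₁⟩ := hφ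
    obtain ⟨m₂, hm₂⟩ := hψ
    exact ⟨max m₁ m₂, (hm₁.mono (le_max_left _ _)).imp (hm₂.mono (le_max_right _ _))⟩
  | @all l φ hφ =>
    obtain ⟨m₁, hm₁⟩ := hφ
    obtain ⟨m₂, hm₂⟩ := H.exists_isDeep (Nat.card (α ⊕ Fin l))
    exact ⟨max m₁ m₂, (hm₁.mono (le_max_left _ _)).all (hm₂.mono le_rfl (le_max_right _ _))⟩

end Determined

section Embedding

variable {M N : Type*} [H.lang.Structure M] [H.lang.Structure N] (e : M ↪[H.lang] N)

theorem adj_embedding_iff {x : Fin (d + 1) → M} : H.Adj (e ∘ x) ↔ H.Adj x :=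
  e.map_rel H.symR x

variable [M ⊨ H.T₀] [N ⊨ H.T₀]

theorem branch_embedding (x : M) : H.branch (e x) = H.branch x := by
  funext n
  have hn := (symQ_iff_restrict_branch (restrict (H.branch x) (n + 1)) (e x)).1
    ((e.map_rel _ fun _ => x).2 ((symQ_iff_restrict_branch _ x).2 rfl))
  exact congrFun hn (Fin.last n)

theorem similar_embedding {P : Type*} [H.lang.Structure P] [P ⊨ H.T₀] (e' : M ↪[H.lang] P)
    {ι : Type*} (a : ι → M) (m : ℕ) : H.Similar m (e ∘ a) (e' ∘ a) where
  eq_iff _ _ := e.injective.eq_iff.trans e'.injective.eq_iff.symm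
  adj_iff t := (adj_embedding_iff e).trans (adj_embedding_iff (x := a ∘ t) e').symm
  restrict_eq i := by simp only [Function.comp_apply, branch_embedding]

end Embedding

section ModelCompletion

theorem IsRich.realize_embedding_iff {M N₁ N₂ : Type w} [H.lang.Structure M]
    [H.lang.Structure N₁] [H.lang.Structure N₂] [M ⊨ H.T₀] [N₁ ⊨ H.T₀] [N₂ ⊨ H.T₀]
    (h₁ : H.IsRich N₁) (h₂ : H.IsRich N₂) (e₁ : M ↪[H.lang] N₁) (e₂ : M ↪[H.lang] N₂)
    {α : Type u} [Finite α] (φ : H.lang.Formula α) (a : α → M) :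
    φ.Realize (e₁ ∘ a) ↔ φ.Realize (e₂ ∘ a) := by
  obtain ⟨m, hm⟩ := exists_isDeterminedAt.{u, w} φ
  refine hm h₁ h₂ ?_
  convert similar_embedding e₁ e₂ (Sum.elim a Fin.elim0) m using 1 <;>
    exact funext fun i => by rcases i with i | i <;> [rfl; exact i.elim0]

theorem isModelCompletion_richTheory : IsModelCompletion.{0, 0, w} H.T₀ H.richTheory where
  models _ hσ := Theory.models_sentence_of_mem (Or.inl hσ)
  embeds M := by
    have : Nonempty (H.FreeExt M) := M.nonempty'.map FreeExt.base
    have := model_richTheory_iff.2 (FreeExt.isRich H M)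
    exact ⟨.of H.richTheory (H.FreeExt M), ⟨FreeExt.embedding H M⟩⟩
  complete M N₁ N₂ e₁ e₂ n φ a := by
    have : N₁ ⊨ H.T₀ := N₁.is_model.mono Set.subset_union_left
    have : N₂ ⊨ H.T₀ := N₂.is_model.mono Set.subset_union_left
    exact (model_richTheory_iff.1 N₁.is_model).realize_embedding_iff
      (model_richTheory_iff.1 N₂.is_model) e₁ e₂ φ a

theorem isRich_of_isModelCompletion {T : H.lang.Theory} (hT : IsModelCompletion.{0, 0, w} H.T₀ T)
    {N : Type w} [H.lang.Structure N] [N ⊨ H.T₀] [N ⊨ T] [Nonempty N] : H.IsRich N := by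
  intro r m hm x ν S hS
  let e := FreeExt.embedding H N
  obtain ⟨y, hy⟩ := FreeExt.isRich H N r m hm (x.trans e.toEmbedding) ν S fun n => by
    convert hS n using 2
    exact congrFun (branch_embedding e _) n
  have hφ : (∃' H.linkFormula ν S).IsExistential := .ex (.of_isQF (isQF_linkFormula ν S))
  have hP : Formula.Realize (∃' H.linkFormula ν S) (e ∘ x) :=
    BoundedFormula.realize_ex.2 ⟨y, realize_linkFormula.2 hy⟩
  obtain ⟨z, hz⟩ := BoundedFormula.realize_ex.1 (hT.realize_of_isExistential e hφ hP)
  exact ⟨z, realize_linkFormula.1 hz⟩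

end ModelCompletion

section Is1167Like

theorem nodeFormula_mem_typeOf_iff {T : H.lang.Theory} {N ι : Type*} [Finite ι]
    [H.lang.Structure N] [N ⊨ T] [N ⊨ H.T₀] [Nonempty N] {m : ℕ} (η : ι → H.Node m) (a : ι → N) :
    Formula.equivSentence (nodeFormula η) ∈ T.typeOf a ↔
      (fun i => restrict (H.branch (a i)) m) = η :=
  Theory.CompleteType.formula_mem_typeOf.trans realize_nodeFormula

theorem existsUnique_nodeFormula_mem {T : H.lang.Theory} (hT : ∀ σ ∈ H.T₀, T ⊨ᵇ σ) {ι : Type*}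
    [Finite ι] (p : T.CompleteType ι) (m : ℕ) :
    ∃! η : ι → H.Node m, Formula.equivSentence (nodeFormula η) ∈ p := by
  obtain ⟨N, a, rfl⟩ := Theory.exists_modelType_is_realized_in T p
  have := model_of_models hT N
  simp only [nodeFormula_mem_typeOf_iff]
  exact existsUnique_eq'

variable (H) in
theorem card_lang_le : H.lang.card ≤ Cardinal.aleph0 := by
  let g : Option (Σ m, H.Node m) → Σ l, H.lang.Relations l := fun o =>
    o.elim ⟨d + 1, Rel.R⟩ fun η => ⟨1, Rel.Q η.2⟩
  have hg : Function.Surjective g := by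
    rintro ⟨_, _ | η⟩
    · exact ⟨none, rfl⟩
    · exact ⟨some ⟨_, η⟩, rfl⟩
  have := hg.countable
  have : ∀ l, Countable (H.lang.Functions l) := fun _ => inferInstanceAs (Countable Empty)
  exact Cardinal.mk_le_aleph0_iff.2 inferInstance

section Edges

variable {N : Type*} [H.lang.Structure N]

theorem realize_edgeFormula {x : Fin 1 → N} {a : Fin d → N} :
    H.edgeFormula.Realize (Sum.elim x a) ↔ H.Adj (Fin.cons (x 0) a) := by
  rw [edgeFormula, Formula.realize_rel]
  refine iff_of_eq (congrArg _ ?_)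
  funext j
  cases j using Fin.cases <;> rfl

theorem exists_adj_of_typeOf_mem_typesP {T : H.lang.Theory} [N ⊨ T] [Nonempty N] {a : Fin d → N}
    (h : T.typeOf a ∈ typesP T H.edgeFormula) : ∃ x, H.Adj (Fin.cons x a) := by
  obtain ⟨x, hx⟩ := Formula.realize_iExs.1 ((Theory.CompleteType.formula_mem_typeOf (T := T)).1 h)
  rw [Formula.realize_relabel] at hx
  have hswap : Sum.elim a x ∘ Sum.swap = Sum.elim x a := funext (by rintro (_ | _) <;> rfl)
  exact ⟨x 0, realize_edgeFormula.1 (hswap ▸ hx)⟩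

theorem IsRich.isPartialType_of_restrict_eq [N ⊨ H.T₀] (h : H.IsRich N) {s m : ℕ}
    (hm : H.IsDeep (s * d) m) {a b : Fin s → Fin d → N} (hb : ∀ l, Function.Injective (b l))
    (hab : ∀ l i, restrict (H.branch (a l i)) m = restrict (H.branch (b l i)) m)
    (ha : IsPartialType H.edgeFormula a) : IsPartialType H.edgeFormula b := by
  obtain ⟨x, hx⟩ := ha
  have hcard : (Set.range fun p : Fin s × Fin d => b p.1 p.2).ncard ≤ s * d := by
    simpa using Finite.card_range_le fun p : Fin s × Fin d => b p.1 p.2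
  have hS (n : Fin m) : H.IsCompatible (H.branch (x 0) n) (fun y : N => H.branch y n)
      {X | ∃ l, Set.range (b l) = X} := by
    refine isCompatible_of_forall_exists ?_
    rintro _ ⟨l, rfl⟩
    refine ⟨b l, hb l, rfl, ?_⟩
    convert (realize_edgeFormula.1 (hx l)).edge_cons n using 2
    exact funext fun i => (congrFun (hab l i) n).symm
  obtain ⟨y, -, -, hy⟩ := h.exists_of_finite (Set.finite_range _) (hm.mono hcard le_rfl) hS
  refine ⟨fun _ => y, fun l => realize_edgeFormula.2 ?_⟩
  exact (hy ⟨b l, hb l⟩ (Set.range_subset_iff.2 fun i => ⟨(l, i), rfl⟩)).2 ⟨l, rfl⟩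

end Edges

theorem is1167Like_of_isModelCompletion {T : H.lang.Theory}
    (hT : IsModelCompletion.{0, 0, w} H.T₀ T) : Is1167Like.{0, 0, w} T H.edgeFormula := by
  choose F hF hF_unique using existsUnique_nodeFormula_mem (ι := Fin d) hT.models
  choose code hcode using fun m => Countable.exists_injective_nat (Fin d → H.Node m)
  refine ⟨H.card_lang_le, fun p m => code m (F p m), fun p _ m => ⟨_, hF p m, fun q _ hq => ?_⟩,
    fun s _ => ?_⟩
  · exact congrArg (code m) (hF_unique q m _ hq).symm
  · obtain ⟨m, hm⟩ := H.exists_isDeep (s * d)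
    refine ⟨m + 1, fun M a b _ hb hab ha => ?_⟩
    have : M ⊨ H.T₀ := model_of_models hT.models M
    have hF_typeOf (c : Fin d → M) : (fun i => restrict (H.branch (c i)) m) = F (T.typeOf c) m :=
      (nodeFormula_mem_typeOf_iff _ c).1 (hF _ m)
    refine (isRich_of_isModelCompletion hT).isPartialType_of_restrict_eq hm (fun l => ?_)
      (fun l => congrFun ?_) ha
    · obtain ⟨x, hx⟩ := exists_adj_of_typeOf_mem_typesP (hb l)
      exact (Fin.cons_injective_iff.1 hx.injective).2
    · rw [hF_typeOf, hF_typeOf]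
      exact hcode m (hab l m m.lt_succ_self)

end Is1167Like

end Template

theorem claimc {d : ℕ} (H : Template d) :
    (∃ T : H.lang.Theory, IsModelCompletion.{0, 0, w} H.T₀ T) ∧
    ∀ T : H.lang.Theory, IsModelCompletion.{0, 0, w} H.T₀ T →
      Is1167Like.{0, 0, w} T H.edgeFormula :=
  ⟨⟨H.richTheory, Template.isModelCompletion_richTheory⟩,
    fun _ hT => Template.is1167Like_of_isModelCompletion hT⟩
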